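/- Let $r\ge 0$ be an integer, let $\mathfrak g=\mathfrak{sl}_{r+1}(\mathbb C)$, let $\mathfrak h\subset\mathfrak g$ be the subalgebra of diagonal matrices, let $\mathfrak n^+$ be the subalgebra of strictly upper triangular matrices, and for $1\le i\le r$ let $x_i^-=E_{i+1,i}$ and $h_i=E_{i,i}-E_{i+1,i+1}$. Let $\omega_1,\dots,\omega_r\in\mathfrak h^*$ be the fundamental weights, $\omega_i(h_j)=\delta_{ij}$. Let $\mathfrak g[t]=\mathfrak g\otimes\mathbb C[t]$ be the current algebra, with bracket $[x\otimes f,y\otimes g]=[x,y]\otimes fg$. For $\lambda=\sum_{i=1}^r m_i\omega_i$ with $m_1,\dots,m_r\in\mathbb Z_{\ge 0}$, the Weyl module $W(\lambda)$ is the $\mathfrak g[t]$-module generated by an element $w_\lambda$ with defining relations $$(\mathfrak n^+\otimes\mathbb C[t])\,w_\lambda=0,\qquad (\mathfrak h\otimes t\,\mathbb C[t])\,w_\lambda=0,\qquad (h\otimes 1)\,w_\lambda=\lambda(h)\,w_\lambda\ \ (h\in\mathfrak h),\qquad (x_i^-\otimes 1)^{m_i+1}w_\lambda=0\ \ (1\le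 i\le r).$$ Then $$\dim_{\mathbb C} W(\lambda)\ \ge\ \prod_{i=1}^r\binom{r+1}{i}^{m_i}.$$ -/

import Mathlib

open scoped TensorProduct Polynomial

noncomputable section

namespace CurrentAlgebra

/-- The Lie algebra `𝔤 = 𝔰𝔩_{r+1}` of complex trace zero matrices of size `r + 1`. The rows and
columns are indexed by `Fin (r + 1)`, and the Dynkin nodes `1, …, r` by `Fin r` (so that
`i : Fin r` stands for the node `i + 1`). -/
abbrev SL (r : ℕ) : Type :=
  LieAlgebra.SpecialLinear.sl (Fin (r + 1)) ℂ

/-- The Cartan subalgebra `𝔥` of diagonal matrices in `𝔰𝔩_{r+1}`. -/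
def cartan (r : ℕ) : Submodule ℂ (SL r) where
  carrier := {x | x.val.IsDiag}
  add_mem' ha hb := Matrix.IsDiag.add ha hb
  zero_mem' := Matrix.isDiag_zero
  smul_mem' c _ hx := Matrix.IsDiag.smul c hx

theorem castSucc_ne_succ {r : ℕ} {i j : Fin r} (h : i ≤ j) : i.castSucc ≠ j.succ :=
  (Fin.castSucc_lt_succ_iff.mpr h).ne

/-- The root vector `x⁺_{i,j}`, `i ≤ j`: the matrix unit in position `(i, j + 1)`. -/
def xPlus {r : ℕ} (i j : Fin r) (h : i ≤ j) : SL r :=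
  LieAlgebra.SpecialLinear.single i.castSucc j.succ (castSucc_ne_succ h) 1

/-- The root vector `x⁻_{i,j}`, `i ≤ j`: the matrix unit in position `(j + 1, i)`. -/
def xMinus {r : ℕ} (i j : Fin r) (h : i ≤ j) : SL r :=
  LieAlgebra.SpecialLinear.single j.succ i.castSucc (castSucc_ne_succ h).symm 1

/-- The coroot `h_i = H_i - H_{i+1} ∈ 𝔥`. -/
def coroot {r : ℕ} (i : Fin r) : cartan r :=
  ⟨LieAlgebra.SpecialLinear.singleSubSingle i.castSucc i.succ 1, by
    intro a b hab
    simp only [LieAlgebra.SpecialLinear.val_singleSubSingle, Matrix.sub_apply, Matrix.single_apply]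
    grind⟩

/-- The fundamental weight `ω_i ∈ 𝔥^*`, which sends a diagonal matrix to the sum of its first `i`
diagonal entries. -/
def fundWeight {r : ℕ} (i : Fin r) : Module.Dual ℂ (cartan r) where
  toFun h := ∑ k ∈ Finset.Iic i.castSucc, h.val.val k k
  map_add' a b := by simp [Finset.sum_add_distrib]
  map_smul' c a := by simp [Finset.mul_sum]

/-- The fundamental weights are dual to the coroots. -/
theorem fundWeight_coroot {r : ℕ} (i j : Fin r) :
    fundWeight i (coroot j) = if i = j then 1 else 0 := by
  have key : ∀ a : Fin (r + 1), (∑ k ∈ Finset.Iic i.castSucc,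
      (Matrix.single a a (1 : ℂ)) k k) = if a ≤ i.castSucc then 1 else 0 := by
    intro a
    simp [Matrix.single_apply]
  change ∑ k ∈ Finset.Iic i.castSucc, (Matrix.single j.castSucc j.castSucc (1 : ℂ)
    - Matrix.single j.succ j.succ (1 : ℂ)) k k = _
  simp only [Matrix.sub_apply, Finset.sum_sub_distrib, key]
  simp only [Fin.le_def, Fin.val_castSucc, Fin.val_succ, Fin.ext_iff]
  split_ifs <;> first | omega | simp

/-- The dominant integral weight `λ = ∑ m_i ω_i`. -/
def weight {r : ℕ} (m : Fin r → ℕ) : Module.Dual ℂ (cartan r) :=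
  ∑ i, m i • fundWeight i

/-- The current algebra `𝔤[t] = 𝔤 ⊗ ℂ[t]`, with bracket `[x ⊗ f, y ⊗ g] = [x, y] ⊗ f g`
(the polynomial is written as the left tensor factor). -/
abbrev Current (r : ℕ) : Type := ℂ[X] ⊗[ℂ] SL r

/-- The universal enveloping algebra `U(𝔤[t])`. -/
abbrev UCurrent (r : ℕ) : Type := UniversalEnvelopingAlgebra ℂ (Current r)

/-- The element `x ⊗ f` of `𝔤[t]`, viewed in `U(𝔤[t])`. -/
def cur {r : ℕ} (x : SL r) (f : ℂ[X]) : UCurrent r :=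
  UniversalEnvelopingAlgebra.ι ℂ (f ⊗ₜ[ℂ] x : Current r)

/-- The elements of `U(𝔤[t])` that the defining relations of the Weyl module `W(∑ m_i ω_i)`
require to annihilate the generator. -/
inductive IsWeylRelator {r : ℕ} (m : Fin r → ℕ) : UCurrent r → Prop
  /-- `𝔫⁺[t] w = 0`; the `x⁺_{i,j}` form a basis of `𝔫⁺`. -/
  | raising (i j : Fin r) (h : i ≤ j) (f : ℂ[X]) : IsWeylRelator m (cur (xPlus i j h) f)
  /-- `𝔥 t[t] w = 0`. -/
  | cartanPos (h : cartan r) (f : ℂ[X]) :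
      IsWeylRelator m (cur h.val (Polynomial.X * f))
  /-- `h w = λ(h) w`. -/
  | highestWeight (h : cartan r) :
      IsWeylRelator m (cur h.val 1 - algebraMap ℂ (UCurrent r) (weight m h))
  /-- `(x⁻_{i,i} ⊗ 1)^{m_i + 1} w = 0`. -/
  | lowering (i : Fin r) : IsWeylRelator m (cur (xMinus i i le_rfl) 1 ^ (m i + 1))

/-- The Weyl module `W(λ)`, `λ = ∑ m_i ω_i`: the cyclic `𝔤[t]`-module (that is, left
`U(𝔤[t])`-module) given by one generator and the relations above, i.e. the quotient of `U(𝔤[t])`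
by the left ideal generated by the relators. -/
abbrev WeylModule {r : ℕ} (m : Fin r → ℕ) : Type :=
  UCurrent r ⧸ Submodule.span (UCurrent r) {u : UCurrent r | IsWeylRelator m u}

end CurrentAlgebra

end

/-! The bound comes from degenerating a tensor product of evaluation modules. Take `m i` copies of
the fundamental representation attached to each node `i`, and let `t` act on copy `k` as `s z_k`,
with distinct `z_k` and a formal parameter `s`, the variable of `ℂ[X]`. Exterior powers are modelled
by maximal minors of generic matrices, so that tensors become products of minors and the Lie algebra
acts by derivations (`matDeriv`, `currentRep`).

Let `v` be the product of the highest weight vectors (`topVector`) and `M` the `ℂ[s]`-span of its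
orbit. Every relator kills `v` except those from `𝔥 ⊗ tℂ[t]`, which send `v` into `sM`; hence `W(λ)`
maps onto `M / sM` (`IsWeylRelator.exists_currentRep_eq_X_smul`). For `s ≠ 0` the points are
distinct, and interpolation isolates the action on a single factor, so every product of minors lies
in `M` up to a nonzero polynomial (`exists_smul_prod_minor_mem`). Thus `M` has an image of full rank
in a finite free `ℂ[s]`-module. That image is free, and its reduction at `s = 0`, a quotient of
`W(λ)`, has dimension equal to that rank (`card_le_rank_quotient_of_degeneration`). -/

noncomputable section

namespace CurrentAlgebra

/-! ### Minors of generic matrices as a model of exterior powers -/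

section Minors

variable {R : Type*} [CommRing R] {K ι : Type*} {d : K → ℕ}

/-- A derivation acts on a determinant row by row. -/
theorem derivation_det {A n : Type*} [CommRing A] [Algebra R A] [Fintype n] [DecidableEq n]
    (D : Derivation R A A) (M : Matrix n n A) :
    D M.det = ∑ p, (M.updateRow p fun q => D (M p q)).det := by
  have key : ∀ τ : Equiv.Perm n, D (∏ p, M p (τ p)) =
      ∑ p, ∏ q, (M.updateRow p fun q => D (M p q)) q (τ q) := by
    intro τ
    have gen : ∀ s : Finset n, D (∏ p ∈ s, M p (τ p)) =
        ∑ p ∈ s, ∏ q ∈ s, (M.updateRow p fun q => D (M p q)) q (τ q) := by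
      intro s
      induction s using Finset.induction_on with
      | empty => simp
      | insert a s ha ih =>
        rw [Finset.prod_insert ha, Derivation.leibniz, ih, Finset.sum_insert ha,
          Finset.prod_insert ha, Matrix.updateRow_self, smul_eq_mul, smul_eq_mul, Finset.mul_sum,
          add_comm]
        congr 1
        · rw [mul_comm]
          congr 1
          refine Finset.prod_congr rfl fun q hq => ?_
          rw [Matrix.updateRow_ne (by rintro rfl; exact ha hq)]
        · refine Finset.sum_congr rfl fun p hp => ?_
          rw [Finset.prod_insert ha, Matrix.updateRow_ne (by rintro rfl; exact ha hp)]
    exact gen _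
  rw [← Matrix.det_transpose, Matrix.det_apply]
  simp only [Matrix.transpose_apply, map_sum]
  have h2 : ∀ p, (M.updateRow p fun q => D (M p q)).det = ∑ τ : Equiv.Perm n,
      Equiv.Perm.sign τ • ∏ q, (M.updateRow p fun q => D (M p q)) q (τ q) := by
    intro p
    rw [← Matrix.det_transpose, Matrix.det_apply]
    rfl
  simp only [h2]
  rw [Finset.sum_comm]
  refine Finset.sum_congr rfl fun τ _ => ?_
  rw [← Finset.smul_sum, ← key, Units.smul_def, Units.smul_def, map_zsmul]

/-- The entries of a family, indexed by `K`, of generic matrices of sizes `ι × d k`. -/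
abbrev Entry (ι : Type*) (d : K → ℕ) : Type _ := Σ k : K, ι × Fin (d k)

/-- The derivation of the ring of polynomials in the entries of generic matrices that is given by
left multiplication of the `k`-th generic matrix by the transpose of `Y k`. -/
def matDeriv [Fintype ι] (d : K → ℕ) (Y : K → Matrix ι ι R) :
    Derivation R (MvPolynomial (Entry ι d) R) (MvPolynomial (Entry ι d) R) :=
  MvPolynomial.mkDerivation R fun x => ∑ a, Y x.1 a x.2.1 • MvPolynomial.X ⟨x.1, a, x.2.2⟩

@[simp]
theorem matDeriv_X [Fintype ι] (Y : K → Matrix ι ι R) (x : Entry ι d) :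
    matDeriv d Y (MvPolynomial.X x) =
      ∑ a, Y x.1 a x.2.1 • MvPolynomial.X (⟨x.1, a, x.2.2⟩ : Entry ι d) :=
  MvPolynomial.mkDerivation_X _ _ _

theorem matDeriv_add [Fintype ι] (Y Z : K → Matrix ι ι R) :
    matDeriv d (Y + Z) = matDeriv d Y + matDeriv d Z := by
  refine MvPolynomial.derivation_ext fun x => ?_
  simp [add_smul, Finset.sum_add_distrib]

theorem matDeriv_smul [Fintype ι] (c : R) (Y : K → Matrix ι ι R) :
    matDeriv d (c • Y) = c • matDeriv d Y := by
  refine MvPolynomial.derivation_ext fun x => ?_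
  simp [mul_smul, Finset.smul_sum]

/-- For a fixed block and column, the variables transform under `Y` as the standard basis vectors
`e_b ↦ Y e_b`. So on variables composition is the matrix product in the same order, and a derivation
is determined by its values there. -/
theorem matDeriv_lie [Fintype ι] [DecidableEq ι] (Y Z : K → Matrix ι ι R) :
    matDeriv d (fun k => ⁅Y k, Z k⁆) = ⁅matDeriv d Y, matDeriv d Z⁆ := by
  refine MvPolynomial.derivation_ext fun x => ?_
  have key : ∀ Y Z : K → Matrix ι ι R, matDeriv d Y (matDeriv d Z (MvPolynomial.X x)) =
      ∑ a, (Y x.1 * Z x.1) a x.2.1 • MvPolynomial.X (⟨x.1, a, x.2.2⟩ : Entry ι d) := by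
    intro Y Z
    simp only [matDeriv_X, map_sum, Derivation.map_smul, Finset.smul_sum, smul_smul,
      Matrix.mul_apply, Finset.sum_smul]
    rw [Finset.sum_comm]
    simp only [mul_comm]
  rw [Derivation.commutator_apply, key, key, matDeriv_X, ← Finset.sum_sub_distrib]
  simp [Ring.lie_def, sub_smul]

/-- The minor of the `k`-th generic matrix with the rows `f 0, f 1, …`. -/
def minor (R : Type*) [CommRing R] (d : K → ℕ) (k : K) (f : Fin (d k) → ι) :
    MvPolynomial (Entry ι d) R :=
  (Matrix.of fun p q => MvPolynomial.X (⟨k, f p, q⟩ : Entry ι d)).det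

theorem minor_eq_zero {k : K} {f : Fin (d k) → ι} {p q : Fin (d k)} (hpq : p ≠ q)
    (h : f p = f q) : minor R d k f = 0 :=
  Matrix.det_zero_of_row_eq hpq (by ext1 c; simp [h])

theorem minor_comp_perm (k : K) (f : Fin (d k) → ι) (τ : Equiv.Perm (Fin (d k))) :
    minor R d k (f ∘ τ) = (Equiv.Perm.sign τ : ℤ) • minor R d k f := by
  have := Matrix.det_permute τ
    (Matrix.of fun p q => (MvPolynomial.X (⟨k, f p, q⟩ : Entry ι d) : MvPolynomial _ R))
  rw [zsmul_eq_mul]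
  exact this

/-- By multilinearity in the rows, a minor transforms as the wedge of the vectors `e_{f p}`. -/
theorem matDeriv_minor [Fintype ι] (Y : K → Matrix ι ι R) (k : K) (f : Fin (d k) → ι) :
    matDeriv d Y (minor R d k f) =
      ∑ p, ∑ a, Y k a (f p) • minor R d k (Function.update f p a) := by
  rw [minor, derivation_det]
  refine Finset.sum_congr rfl fun p _ => ?_
  have h1 : (fun q => matDeriv d Y ((Matrix.of fun p q =>
      (MvPolynomial.X (⟨k, f p, q⟩ : Entry ι d) : MvPolynomial _ R)) p q)) =
      ∑ a, Y k a (f p) • fun q => MvPolynomial.X (⟨k, a, q⟩ : Entry ι d) := by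
    ext1 q
    simp
  rw [h1]
  have h2 := (Matrix.detRowAlternating (R := MvPolynomial (Entry ι d) R)
    (n := Fin (d k))).toMultilinearMap.map_update_sum Finset.univ p
      (fun a q => Y k a (f p) • MvPolynomial.X (⟨k, a, q⟩ : Entry ι d))
      (Matrix.of fun p q => (MvPolynomial.X (⟨k, f p, q⟩ : Entry ι d) : MvPolynomial _ R))
  refine h2.trans (Finset.sum_congr rfl fun a _ => ?_)
  have h3 := Matrix.det_updateRow_smul
    (Matrix.of fun p q => (MvPolynomial.X (⟨k, f p, q⟩ : Entry ι d) : MvPolynomial _ R)) p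
    (MvPolynomial.C (Y k a (f p))) (fun q => MvPolynomial.X (⟨k, a, q⟩ : Entry ι d))
  rw [MvPolynomial.smul_eq_C_mul]
  refine Eq.trans ?_ (h3.trans ?_)
  · refine congrArg (fun w => (Matrix.updateRow (Matrix.of fun p q =>
      (MvPolynomial.X (⟨k, f p, q⟩ : Entry ι d) : MvPolynomial _ R)) p w).det) ?_
    ext1 q
    simp [MvPolynomial.smul_eq_C_mul]
  · congr 2
    ext u v
    by_cases hu : u = p
    · subst hu; simp
    · simp [Matrix.updateRow_ne hu, Function.update_of_ne hu]

/-- A diagonal matrix scales a minor by the sum of its entries at the rows of the minor. -/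
theorem matDeriv_minor_of_isDiag [Fintype ι] {Y : K → Matrix ι ι R} {k : K} (hY : (Y k).IsDiag)
    (f : Fin (d k) → ι) :
    matDeriv d Y (minor R d k f) = (∑ p, Y k (f p) (f p)) • minor R d k f := by
  rw [matDeriv_minor, Finset.sum_smul]
  refine Finset.sum_congr rfl fun p _ => ?_
  rw [Finset.sum_eq_single (f p) (fun a _ ha => by rw [hY ha, zero_smul]) (by simp),
    Function.update_eq_self]

theorem matDeriv_minor_single_eq_zero [Fintype ι] [DecidableEq ι] {Y : K → Matrix ι ι R} {k : K}
    {a b : ι} {c : R} (hY : Y k = Matrix.single a b c) {f : Fin (d k) → ι} (hf : ∀ p, f p ≠ b) :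
    matDeriv d Y (minor R d k f) = 0 := by
  rw [matDeriv_minor]
  refine Finset.sum_eq_zero fun p _ => Finset.sum_eq_zero fun a' _ => ?_
  rw [hY, Matrix.single_apply, if_neg (fun h => hf p h.2.symm), zero_smul]

/-- The matrix unit in position `(a, b)` replaces the row `b` of a minor by the row `a`. -/
theorem matDeriv_minor_single [Fintype ι] [DecidableEq ι] {Y : K → Matrix ι ι R} {k : K}
    {a : ι} {c : R} {f : Fin (d k) → ι} (hf : Function.Injective f) {p : Fin (d k)}
    (hY : Y k = Matrix.single a (f p) c) :
    matDeriv d Y (minor R d k f) = c • minor R d k (Function.update f p a) := by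
  rw [matDeriv_minor, Finset.sum_eq_single p, Finset.sum_eq_single a]
  · simp [hY]
  · intro a' _ ha
    rw [hY, Matrix.single_apply, if_neg (fun h => ha h.1.symm), zero_smul]
  · simp
  · intro q _ hq
    refine Finset.sum_eq_zero fun a' _ => ?_
    rw [hY, Matrix.single_apply, if_neg (fun h => hq (hf h.2.symm)), zero_smul]
  · simp

theorem matDeriv_minor_eq_zero [Fintype ι] {Y : K → Matrix ι ι R} {k : K} (hY : Y k = 0)
    (f : Fin (d k) → ι) : matDeriv d Y (minor R d k f) = 0 := by
  simp [matDeriv_minor, hY]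

end Minors

/-! ### Derivations acting on products -/

section Products

variable {R A K : Type*} [CommRing R] [CommRing A] [Algebra R A]

theorem derivation_prod_eq_zero (D : Derivation R A A) (s : Finset K) (g : K → A)
    (h : ∀ k ∈ s, D (g k) = 0) : D (∏ k ∈ s, g k) = 0 := by
  classical
  induction s using Finset.induction_on with
  | empty => simp
  | insert a s ha ih =>
    rw [Finset.prod_insert ha, Derivation.leibniz, h a (by simp),
      ih fun k hk => h k (by simp [hk])]
    simp

theorem derivation_prod_eigen (D : Derivation R A A) (s : Finset K) (g : K → A) (c : K → R)
    (h : ∀ k ∈ s, D (g k) = c k • g k) : D (∏ k ∈ s, g k) = (∑ k ∈ s, c k) • ∏ k ∈ s, g k := by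
  classical
  induction s using Finset.induction_on with
  | empty => simp
  | insert a s ha ih =>
    rw [Finset.prod_insert ha, Derivation.leibniz, h a (by simp),
      ih fun k hk => h k (by simp [hk]), Finset.sum_insert ha]
    simp only [smul_eq_mul, Algebra.smul_def, map_add]
    ring

/-- The higher Leibniz rule stops after two terms because `D ^ 2` kills `p`. -/
theorem derivation_pow_mul_apply (D : Derivation R A A) (p q : A) (hp : D (D p) = 0) (j : ℕ) :
    ((D : A →ₗ[R] A) ^ (j + 1)) (p * q) =
      p * ((D : A →ₗ[R] A) ^ (j + 1)) q + (j + 1 : ℕ) * (D p * ((D : A →ₗ[R] A) ^ j) q) := by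
  induction j with
  | zero => simp [Derivation.leibniz]; ring
  | succ j ih =>
    rw [pow_succ' _ (j + 1), Module.End.mul_apply, ih, Module.End.mul_apply,
      pow_succ' _ j, Module.End.mul_apply]
    simp only [Derivation.coeFn_coe, map_add, Derivation.leibniz, smul_eq_mul, hp,
      Derivation.map_natCast]
    push_cast
    ring

/-- A product over `s` of factors that are killed by `D ^ 2`, of which all but those in `T` are
killed by `D`, is killed by `D ^ ((s ∩ T).card + 1)`. -/
theorem derivation_pow_prod_eq_zero [DecidableEq K] (D : Derivation R A A) (s T : Finset K)
    (g : K → A) (h : ∀ k ∈ s, k ∉ T → D (g k) = 0) (h2 : ∀ k ∈ s, D (D (g k)) = 0) :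
    ((D : A →ₗ[R] A) ^ ((s ∩ T).card + 1)) (∏ k ∈ s, g k) = 0 := by
  induction s using Finset.induction_on with
  | empty => simp
  | insert a s ha ih =>
    have ih := ih (fun k hk => h k (by simp [hk])) (fun k hk => h2 k (by simp [hk]))
    rw [Finset.prod_insert ha]
    by_cases haT : a ∈ T
    · rw [Finset.insert_inter_of_mem haT, Finset.card_insert_of_notMem (by simp [ha]),
        derivation_pow_mul_apply _ _ _ (h2 a (by simp)), pow_succ', Module.End.mul_apply, ih]
      simp
    · rw [Finset.insert_inter_of_notMem haT, derivation_pow_mul_apply _ _ _ (h2 a (by simp)), ih,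
        h a (by simp) haT]
      simp

end Products

/-! ### Specialization of a lattice at `X = 0` -/

/-- If the orbit map of `v` sends all generators of a left ideal into `X • M`, where `M` is the
`k[X]`-span of the orbit, and a linear image of `M` in `k[X]^d` has full rank, then the quotient by
the left ideal has dimension at least `d`. -/
theorem card_le_rank_quotient_of_degeneration {k U A J : Type*} [Field k] [Ring U] [Algebra k U]
    [AddCommGroup A] [Module k[X] A] [Module k A] [IsScalarTower k k[X] A] [Fintype J]
    [DecidableEq J]
    (ρ : U →ₐ[k] Module.End k[X] A) (v : A) (S : Set U) (π : A →ₗ[k[X]] (J → k[X]))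
    (hS : ∀ u ∈ S, ∃ w ∈ Submodule.span k[X] (Set.range fun u => ρ u v),
      ρ u v = (Polynomial.X : k[X]) • w)
    (hπ : ∀ j, ∃ c : k[X], c ≠ 0 ∧ ∃ w ∈ Submodule.span k[X] (Set.range fun u => ρ u v),
      π w = Pi.single j c) :
    (Fintype.card J : Cardinal) ≤ Module.rank k (U ⧸ Submodule.span U S) := by
  set M : Submodule k[X] A := Submodule.span k[X] (Set.range fun u => ρ u v) with hM
  have hUM : ∀ u, ∀ w ∈ M, ρ u w ∈ M := by
    intro u w hw
    have : M ≤ M.comap (ρ u) := by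
      rw [hM, Submodule.span_le]
      rintro _ ⟨u', rfl⟩
      exact Submodule.subset_span ⟨u * u', by simp⟩
    exact this hw
  have hideal : ∀ u ∈ Submodule.span U S, ∃ w ∈ M, ρ u v = (Polynomial.X : k[X]) • w := by
    intro u hu
    induction hu using Submodule.span_induction with
    | mem u hu => exact hS u hu
    | zero => exact ⟨0, M.zero_mem, by simp⟩
    | add x y _ _ hx hy =>
      obtain ⟨a, ha, ha'⟩ := hx
      obtain ⟨b, hb, hb'⟩ := hy
      exact ⟨a + b, M.add_mem ha hb, by simp [ha', hb']⟩
    | smul u x _ hx =>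
      obtain ⟨a, ha, ha'⟩ := hx
      exact ⟨ρ u a, hUM u a ha, by simp [ha']⟩
  -- Modulo `X` the span of the orbit is the orbit itself, since a polynomial scalar reduces to its
  -- constant term.
  have hmod : ∀ w ∈ M, ∃ u : U, ∃ w' ∈ M, w = ρ u v + (Polynomial.X : k[X]) • w' := by
    intro w hw
    induction hw using Submodule.span_induction with
    | mem x hx =>
      obtain ⟨u, rfl⟩ := hx
      exact ⟨u, 0, M.zero_mem, by simp⟩
    | zero => exact ⟨0, 0, M.zero_mem, by simp⟩
    | add x y _ _ hx hy =>
      obtain ⟨u, a, ha, rfl⟩ := hx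
      obtain ⟨u', b, hb, rfl⟩ := hy
      refine ⟨u + u', a + b, M.add_mem ha hb, ?_⟩
      simp only [map_add, LinearMap.add_apply, smul_add]
      abel
    | smul p x hx' hx =>
      obtain ⟨u, a, ha, rfl⟩ := hx
      refine ⟨p.coeff 0 • u, p • a + p.divX • ρ u v,
        M.add_mem (M.smul_mem _ ha) (M.smul_mem _ (Submodule.subset_span ⟨u, rfl⟩)), ?_⟩
      have h1 : (Polynomial.C (p.coeff 0) : k[X]) • ρ u v = p.coeff 0 • ρ u v := by
        rw [← Polynomial.algebraMap_eq, algebraMap_smul]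
      have h2 : p • (Polynomial.X : k[X]) • a = (Polynomial.X : k[X]) • p • a := smul_comm _ _ _
      have h3 : p • ρ u v = (Polynomial.X : k[X]) • p.divX • ρ u v + p.coeff 0 • ρ u v := by
        conv_lhs => rw [← Polynomial.divX_mul_X_add p]
        rw [add_smul, h1, mul_comm, mul_smul]
      rw [smul_add, h2, h3, map_smul, LinearMap.smul_apply, smul_add]
      abel
  -- `M` need not be finitely generated or free, but its image in `J → k[X]` is free of finite rank.
  obtain ⟨n, ⟨b⟩⟩ := Submodule.nonempty_basis_of_pid (Pi.basisFun k[X] J) (M.map π)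
  have hcard : Fintype.card J ≤ n := by
    choose c hc w hw hπw using hπ
    have hli : LinearIndependent k[X]
        (fun j => (⟨π (w j), Submodule.mem_map_of_mem (hw j)⟩ : M.map π)) := by
      refine LinearIndependent.of_comp (M.map π).subtype ?_
      rw [Fintype.linearIndependent_iff]
      intro g hg j
      have := congrFun hg j
      simp only [Function.comp_apply, Submodule.subtype_apply, hπw, Finset.sum_apply,
        Pi.smul_apply, smul_eq_mul, Pi.zero_apply, Pi.single_apply] at this
      simpa [hc j] using this
    have := Module.Free.of_basis b
    have := Module.Finite.of_basis b
    have h := hli.fintype_card_le_finrank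
    rwa [Module.finrank_eq_card_basis b, Fintype.card_fin] at h
  have hb : ∀ i, ∃ u : U, ∃ w' ∈ M, (b i : J → k[X]) = π (ρ u v) + (Polynomial.X : k[X]) • π w' := by
    intro i
    obtain ⟨w, hw, hw'⟩ := (b i).2
    obtain ⟨u, w', h, rfl⟩ := hmod w hw
    exact ⟨u, w', h, by rw [← hw']; simp⟩
  choose u w' hw' hbu using hb
  -- A relation among the classes of the `u i` puts `∑ g i • b i` in `X • π(M)`; the constant terms
  -- of its coordinates in the basis `b` then force `g = 0`.
  have hli : LinearIndependent k (fun i => (Submodule.span U S).mkQ (u i)) := by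
    rw [Fintype.linearIndependent_iff]
    intro g hg i
    have h0 : ∑ i, g i • u i ∈ Submodule.span U S := by
      rw [← Submodule.Quotient.mk_eq_zero, ← hg, ← Submodule.mkQ_apply, map_sum]
      rfl
    obtain ⟨a, ha, ha'⟩ := hideal _ h0
    have hCA : ∀ (c : k) (x : A), (Polynomial.C c : k[X]) • x = c • x := fun c x => by
      rw [← Polynomial.algebraMap_eq, algebraMap_smul]
    let y : M.map π := ⟨π (a + ∑ i, (Polynomial.C (g i) : k[X]) • w' i),
      Submodule.mem_map_of_mem (M.add_mem ha (M.sum_mem fun i _ => M.smul_mem _ (hw' i)))⟩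
    have hsum : ∑ i, (Polynomial.C (g i) : k[X]) • b i = (Polynomial.X : k[X]) • y := by
      apply Subtype.ext
      have h1 : π (ρ (∑ i, g i • u i) v) = ∑ i, (Polynomial.C (g i) : k[X]) • π (ρ (u i) v) := by
        simp only [map_sum, map_smul, LinearMap.sum_apply, LinearMap.smul_apply, ← hCA]
      rw [ha', map_smul] at h1
      simp only [y, Submodule.coe_sum, Submodule.coe_smul, hbu, smul_add, Finset.sum_add_distrib,
        map_add, map_sum, map_smul, h1, Finset.smul_sum]
      congr 1
      exact Finset.sum_congr rfl fun i _ => smul_comm _ _ _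
    have h2 := congrArg (fun q => b.repr q i) hsum
    simp only [map_sum, map_smul, Module.Basis.repr_self, Finsupp.finsetSum_apply,
      Finsupp.smul_apply, Finsupp.single_apply, smul_eq_mul] at h2
    have h3 := congrArg (fun q => Polynomial.coeff q 0) h2
    simpa using h3
  have h := hli.cardinal_lift_le_rank
  simp only [Cardinal.mk_fin, Cardinal.lift_natCast] at h
  have h' : (n : Cardinal) ≤ Module.rank k (U ⧸ Submodule.span U S) := by
    simpa using h
  exact le_trans (by exact_mod_cast hcard) h'

/-! ### The current algebra acting through evaluation at the points `s z_k` -/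

section Representation

attribute [local instance] LieRing.ofAssociativeRing

variable {r : ℕ} {K : Type*}

/-- The specialization of the current algebra at the points `s z_k`, `k : K`, where `s` is the
variable of `ℂ[X]`. -/
def specialize (r : ℕ) (z : K → ℂ) :
    Current r →ₗ[ℂ] (K → Matrix (Fin (r + 1)) (Fin (r + 1)) ℂ[X]) :=
  TensorProduct.lift (LinearMap.mk₂ ℂ
    (fun f x k => f.comp (Polynomial.C (z k) * Polynomial.X) • x.val.map Polynomial.C)
    (fun f g x => by ext1 k; simp [add_smul])
    (fun c f x => by ext1 k; simp)
    (fun f x y => by ext1 k; simp [Matrix.map_add])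
    (fun c f x => by
      ext1 k
      refine Matrix.ext fun a b => ?_
      change _ * Polynomial.C (c * x.val a b) = c • (_ * Polynomial.C (x.val a b))
      rw [Polynomial.smul_eq_C_mul, Polynomial.C_mul]
      ring))

theorem specialize_tmul (z : K → ℂ) (f : ℂ[X]) (x : SL r) (k : K) :
    specialize r z (f ⊗ₜ x) k =
      f.comp (Polynomial.C (z k) * Polynomial.X) • x.val.map Polynomial.C := rfl

theorem specialize_lie (z : K → ℂ) (x y : Current r) :
    specialize r z ⁅x, y⁆ = fun k => ⁅specialize r z x k, specialize r z y k⁆ := by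
  induction x using TensorProduct.induction_on with
  | zero =>
    have h : ⁅(0 : Current r), y⁆ = 0 := zero_lie y
    ext1 k
    rw [h, map_zero, Pi.zero_apply, zero_lie]
  | add x x' hx hx' =>
    have h : ⁅(x + x' : Current r), y⁆ = ⁅x, y⁆ + ⁅x', y⁆ := add_lie x x' y
    ext1 k
    rw [h, map_add, hx, hx', map_add]
    simp only [Pi.add_apply, add_lie]
  | tmul f x =>
    induction y using TensorProduct.induction_on with
    | zero =>
      have h : ⁅(f ⊗ₜ x : Current r), (0 : Current r)⁆ = 0 := lie_zero (f ⊗ₜ x : Current r)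
      ext1 k
      rw [h, map_zero, Pi.zero_apply, lie_zero]
    | add y y' hy hy' =>
      have h : ⁅(f ⊗ₜ x : Current r), (y + y' : Current r)⁆ = ⁅f ⊗ₜ x, y⁆ + ⁅f ⊗ₜ x, y'⁆ :=
        lie_add (f ⊗ₜ x : Current r) y y'
      ext1 k
      rw [h, map_add, hy, hy', map_add]
      simp only [Pi.add_apply, lie_add]
    | tmul g y =>
      ext1 k
      rw [LieAlgebra.ExtendScalars.bracket_tmul, specialize_tmul, specialize_tmul,
        specialize_tmul, Ring.lie_def, smul_mul_smul_comm, smul_mul_smul_comm, Polynomial.mul_comp,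
        mul_comm (g.comp _), ← smul_sub, ← Matrix.map_mul, ← Matrix.map_mul,
        LieAlgebra.SpecialLinear.sl_bracket, Matrix.map_sub _ (by simp)]

/-- The ring of polynomials in the entries of generic matrices, with coefficients in `ℂ[X]`. -/
abbrev MinorRing (r : ℕ) (d : K → ℕ) : Type _ := MvPolynomial (Entry (Fin (r + 1)) d) ℂ[X]

/-- The action of the current algebra by derivations. -/
def currentHom (r : ℕ) (d : K → ℕ) (z : K → ℂ) :
    Current r →ₗ⁅ℂ⁆ Module.End ℂ[X] (MinorRing r d) where
  toFun x := (matDeriv d (specialize r z x)).toLinearMap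
  map_add' x y := by rw [map_add, matDeriv_add]; rfl
  map_smul' c x := by
    have : specialize r z (c • x) = (Polynomial.C c : ℂ[X]) • specialize r z x := by
      rw [map_smul, ← Polynomial.algebraMap_eq, algebraMap_smul]
    rw [this, matDeriv_smul]
    refine LinearMap.ext fun p => ?_
    exact algebraMap_smul ℂ[X] c (matDeriv d (specialize r z x) p)
  map_lie' {x y} := by
    rw [specialize_lie, matDeriv_lie]
    exact Derivation.commutator_coe_linear_map

/-- The action of the universal enveloping algebra. -/
def currentRep (r : ℕ) (d : K → ℕ) (z : K → ℂ) :
    UCurrent r →ₐ[ℂ] Module.End ℂ[X] (MinorRing r d) :=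
  UniversalEnvelopingAlgebra.lift ℂ (currentHom r d z)

theorem currentRep_cur (d : K → ℕ) (z : K → ℂ) (x : SL r) (f : ℂ[X]) :
    currentRep r d z (cur x f) = (matDeriv d (specialize r z (f ⊗ₜ x))).toLinearMap :=
  UniversalEnvelopingAlgebra.lift_ι_apply ℂ _ _

end Representation

/-! ### Full rank of the span of the orbit -/

section Degeneration

variable {r : ℕ} {K : Type*} {d : K → ℕ}

theorem specialize_single (z : K → ℂ) (f : ℂ[X]) {a b : Fin (r + 1)} (h : a ≠ b) (k : K) :
    specialize r z (f ⊗ₜ LieAlgebra.SpecialLinear.single a b h 1) k =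
      Matrix.single a b (f.comp (Polynomial.C (z k) * Polynomial.X)) := by
  rw [specialize_tmul, LieAlgebra.SpecialLinear.val_single, Matrix.map_single _ _ _ Polynomial.C,
    Matrix.smul_single]
  simp

variable [Fintype K]

/-- The product of the topmost maximal minors. -/
def topVector (r : ℕ) (hd : ∀ k, d k ≤ r + 1) : MinorRing r d :=
  ∏ k, minor ℂ[X] d k (Fin.castLE (hd k))

/-- The `ℂ[X]`-span of the orbit of `topVector` under the current algebra. -/
def orbitSpan (r : ℕ) (hd : ∀ k, d k ≤ r + 1) (z : K → ℂ) : Submodule ℂ[X] (MinorRing r d) :=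
  Submodule.span ℂ[X] (Set.range fun u => currentRep r d z u (topVector r hd))

theorem topVector_mem_orbitSpan (hd : ∀ k, d k ≤ r + 1) (z : K → ℂ) :
    topVector r hd ∈ orbitSpan r hd z :=
  Submodule.subset_span ⟨1, by simp⟩

theorem matDeriv_mem_orbitSpan {hd : ∀ k, d k ≤ r + 1} {z : K → ℂ} {w : MinorRing r d}
    (hw : w ∈ orbitSpan r hd z) (x : SL r) (f : ℂ[X]) :
    matDeriv d (specialize r z (f ⊗ₜ x)) w ∈ orbitSpan r hd z := by
  have : orbitSpan r hd z ≤
      (orbitSpan r hd z).comap (matDeriv d (specialize r z (f ⊗ₜ x))).toLinearMap := by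
    conv_lhs => rw [orbitSpan]
    rw [Submodule.span_le]
    rintro _ ⟨u, rfl⟩
    refine Submodule.subset_span ⟨cur x f * u, ?_⟩
    simp only [map_mul, currentRep_cur, Module.End.mul_apply]
  exact this hw

/-- Since the points are distinct, a nonzero multiple of every matrix unit acting on a single block
preserves the span of the orbit. -/
theorem exists_smul_matDeriv_single_mem [DecidableEq K] (hd : ∀ k, d k ≤ r + 1) {z : K → ℂ}
    (hz : Function.Injective z) (k₀ : K) {a b : Fin (r + 1)} (hab : a ≠ b) :
    ∃ c : ℂ[X], c ≠ 0 ∧ ∀ w ∈ orbitSpan r hd z,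
      c • matDeriv d (Pi.single k₀ (Matrix.single a b 1)) w ∈ orbitSpan r hd z := by
  let y : K → ℂ[X] := fun k => Polynomial.C (z k) * Polynomial.X
  have hy : Function.Injective y := fun k l hkl =>
    hz (Polynomial.C_injective (mul_right_cancel₀ Polynomial.X_ne_zero hkl))
  -- Acting by `∑ g_j (x ⊗ t^j)` multiplies `x` by `g (y k)` on block `k`; this `g` vanishes at
  -- every `y k` except `y k₀`.
  let g : Polynomial ℂ[X] := ∏ k ∈ Finset.univ.erase k₀, (Polynomial.X - Polynomial.C (y k))
  have hg : ∀ k, g.eval (y k) = ∏ l ∈ Finset.univ.erase k₀, (y k - y l) := by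
    intro k
    simp [g, Polynomial.eval_prod]
  refine ⟨g.eval (y k₀), ?_, fun w hw => ?_⟩
  · rw [hg, Finset.prod_ne_zero_iff]
    intro l hl
    exact sub_ne_zero.mpr (hy.ne (Finset.ne_of_mem_erase hl).symm)
  · have hY : g.eval (y k₀) • (Pi.single k₀ (Matrix.single a b 1) :
        K → Matrix (Fin (r + 1)) (Fin (r + 1)) ℂ[X]) =
        ∑ j ∈ Finset.range (g.natDegree + 1), g.coeff j • specialize r z
          (((Polynomial.X : ℂ[X]) ^ j) ⊗ₜ LieAlgebra.SpecialLinear.single a b hab 1) := by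
      ext1 k
      simp only [Finset.sum_apply, Pi.smul_apply, specialize_single, Polynomial.X_pow_comp,
        Matrix.smul_single]
      have hsum : ∑ j ∈ Finset.range (g.natDegree + 1), Matrix.single a b (g.coeff j • y k ^ j) =
          Matrix.single a b (g.eval (y k)) := by
        rw [Polynomial.eval_eq_sum_range]
        exact (map_sum (Matrix.singleAddMonoidHom (α := ℂ[X]) a b) _ _).symm
      refine Eq.trans ?_ hsum.symm
      by_cases hk : k = k₀
      · subst hk
        simp
      · have : g.eval (y k) = 0 := by
          rw [hg]
          exact Finset.prod_eq_zero (Finset.mem_erase.mpr ⟨hk, Finset.mem_univ _⟩) (sub_self _)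
        simp [this, hk]
    rw [← Derivation.smul_apply, ← matDeriv_smul, hY]
    refine Finset.sum_induction _ (fun Y => matDeriv d Y w ∈ orbitSpan r hd z) ?_ ?_ ?_
    · intro Y Z h h'
      rw [matDeriv_add]
      exact Submodule.add_mem _ h h'
    · have := matDeriv_smul (d := d) 0 (0 : K → Matrix (Fin (r + 1)) (Fin (r + 1)) ℂ[X])
      rw [zero_smul, zero_smul] at this
      rw [this]
      exact Submodule.zero_mem _
    · intro j _
      rw [matDeriv_smul]
      exact Submodule.smul_mem _ _ (matDeriv_mem_orbitSpan hw _ _)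

/-- Every product of minors has a nonzero multiple in the span of the orbit. -/
theorem exists_smul_prod_minor_mem (hd : ∀ k, d k ≤ r + 1) {z : K → ℂ}
    (hz : Function.Injective z) (F : ∀ k, Fin (d k) → Fin (r + 1))
    (hF : ∀ k, Function.Injective (F k)) :
    ∃ c : ℂ[X], c ≠ 0 ∧ c • ∏ k, minor ℂ[X] d k (F k) ∈ orbitSpan r hd z := by
  classical
  -- Induction on the number of chosen rows outside the top `d k` rows of their block. When there
  -- are none, each minor is the top one up to a permutation of its rows.
  induction hN : (Finset.univ.filter fun x : Σ k, Fin (d k) => d x.1 ≤ F x.1 x.2).card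
    using Nat.strong_induction_on generalizing F with
  | _ N ih =>
    by_cases hlt : ∀ k p, (F k p : ℕ) < d k
    · refine ⟨1, one_ne_zero, ?_⟩
      have hinj : ∀ k, Function.Injective fun p => (⟨F k p, hlt k p⟩ : Fin (d k)) := by
        intro k p q hpq
        exact hF k (Fin.ext (Fin.mk.inj_iff.mp hpq))
      let τ : ∀ k, Equiv.Perm (Fin (d k)) := fun k =>
        Equiv.ofBijective _ (Finite.injective_iff_bijective.mp (hinj k))
      have hτ : ∀ k, F k = Fin.castLE (hd k) ∘ τ k := fun k => rfl
      have : ∏ k, minor ℂ[X] d k (F k) =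
          (∏ k, (Equiv.Perm.sign (τ k) : ℤ)) • topVector r hd := by
        rw [topVector, zsmul_eq_mul, Int.cast_prod, ← Finset.prod_mul_distrib]
        refine Finset.prod_congr rfl fun k _ => ?_
        rw [hτ, minor_comp_perm, zsmul_eq_mul]
      rw [one_smul, this]
      exact zsmul_mem (topVector_mem_orbitSpan hd z) _
    · push Not at hlt
      obtain ⟨k₀, p₀, hp₀⟩ := hlt
      -- Pigeonhole: a block using a row below the top ones misses some top row.
      obtain ⟨q₀, hq₀⟩ : ∃ q, ∀ p, F k₀ p ≠ Fin.castLE (hd k₀) q := by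
        by_contra! h
        choose g hg using h
        have hginj : Function.Injective g := fun q q' h' =>
          Fin.castLE_injective (hd k₀) (by rw [← hg, ← hg, h'])
        obtain ⟨q, hq⟩ := Finite.injective_iff_surjective.mp hginj p₀
        have := hg q
        rw [hq] at this
        rw [this] at hp₀
        exact absurd q.isLt (not_lt.mpr hp₀)
      set b : Fin (r + 1) := Fin.castLE (hd k₀) q₀ with hb
      -- Put the missed top row in place of the low one; the matrix unit at `(F k₀ p₀, b)` on block
      -- `k₀` recovers `F` from `F'`.
      let F' := Function.update F k₀ (Function.update (F k₀) p₀ b)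
      have hF'k : F' k₀ = Function.update (F k₀) p₀ b := Function.update_self ..
      have hF'ne : ∀ k, k ≠ k₀ → F' k = F k := fun k hk => Function.update_of_ne hk ..
      have hinj : Function.Injective (F' k₀) := by
        rw [hF'k]
        intro p q hpq
        by_cases hp : p = p₀ <;> by_cases hq : q = p₀
        · rw [hp, hq]
        · subst hp
          rw [Function.update_self, Function.update_of_ne hq] at hpq
          exact absurd hpq.symm (hq₀ q)
        · subst hq
          rw [Function.update_self, Function.update_of_ne hp] at hpq
          exact absurd hpq (hq₀ p)
        · rw [Function.update_of_ne hp, Function.update_of_ne hq] at hpq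
          exact hF k₀ hpq
      have hF' : ∀ k, Function.Injective (F' k) := by
        intro k
        by_cases hk : k = k₀
        · subst hk
          exact hinj
        · rw [hF'ne k hk]
          exact hF k
      have hcard : (Finset.univ.filter fun x : Σ k, Fin (d k) => d x.1 ≤ F' x.1 x.2).card < N := by
        rw [← hN]
        refine Finset.card_lt_card (Finset.ssubset_iff_of_subset ?_ |>.mpr ⟨⟨k₀, p₀⟩, ?_, ?_⟩)
        · rintro ⟨k, p⟩ hx
          simp only [Finset.mem_filter, Finset.mem_univ, true_and] at hx ⊢
          by_cases hk : k = k₀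
          · subst hk
            rw [hF'k] at hx
            by_cases hp : p = p₀
            · rw [hp]
              exact hp₀
            · rwa [Function.update_of_ne hp] at hx
          · rwa [hF'ne k hk] at hx
        · simpa using hp₀
        · simp [hF'k, hb]
      obtain ⟨c, hc, hcm⟩ := ih _ hcard F' hF' rfl
      have hab : F k₀ p₀ ≠ b := hq₀ p₀
      obtain ⟨c', hc', hcm'⟩ := exists_smul_matDeriv_single_mem hd hz k₀ hab
      refine ⟨c' * c, mul_ne_zero hc' hc, ?_⟩
      have h := hcm' _ hcm
      rw [Derivation.map_smul, smul_smul] at h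
      convert h using 2
      rw [← Finset.mul_prod_erase _ _ (Finset.mem_univ k₀),
        ← Finset.mul_prod_erase _ (fun k => minor ℂ[X] d k (F' k)) (Finset.mem_univ k₀),
        Derivation.leibniz, derivation_prod_eq_zero, smul_zero, zero_add,
        matDeriv_minor_single (p := p₀) (a := F k₀ p₀) (c := 1) hinj, one_smul, smul_eq_mul,
        mul_comm]
      · congr 1
        · exact Finset.prod_congr rfl fun k hk => by rw [hF'ne k (Finset.ne_of_mem_erase hk)]
        · rw [hF'k, Function.update_idem, Function.update_eq_self]
      · rw [Pi.single_eq_same, hF'k, Function.update_self]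
      · intro k hk
        exact matDeriv_minor_eq_zero (Pi.single_eq_of_ne (Finset.ne_of_mem_erase hk) _) _

/-- The indices of the products of maximal minors: one set of rows for every block. -/
abbrev RowSets (r : ℕ) (d : K → ℕ) : Type _ :=
  ∀ k, {S : Finset (Fin (r + 1)) // S.card = d k}

/-- The rows in increasing order. -/
def rows (S : RowSets r d) (k : K) : Fin (d k) → Fin (r + 1) :=
  (S k).1.orderEmbOfFin (S k).2

/-- The point at which the product of the minors with the rows `S` is `1` and all others vanish. -/
def rowPoint (S : RowSets r d) : Entry (Fin (r + 1)) d → ℂ[X] :=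
  fun x => if rows S x.1 x.2.2 = x.2.1 then 1 else 0

/-- If `S = T`, every minor becomes the determinant of the identity. Otherwise some `T k` has a row
outside `S k`, the two having equal size, and that row is zero at the point. -/
theorem aeval_rowPoint_prod_minor [DecidableEq (RowSets r d)] (S T : RowSets r d) :
    MvPolynomial.aeval (rowPoint S) (∏ k, minor ℂ[X] d k (rows T k)) =
      if S = T then 1 else 0 := by
  have hmin : ∀ k, MvPolynomial.aeval (rowPoint S) (minor ℂ[X] d k (rows T k)) =
      (Matrix.of fun p q => if rows S k q = rows T k p then (1 : ℂ[X]) else 0).det := by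
    intro k
    rw [minor, AlgHom.map_det]
    congr 1
    ext1 p q
    simp [rowPoint]
  simp only [map_prod, hmin]
  split_ifs with h
  · subst h
    refine Finset.prod_eq_one fun k _ => ?_
    rw [← Matrix.det_one (n := Fin (d k))]
    congr 1
    ext1 p q
    simp [rows, Matrix.one_apply, eq_comm]
  · obtain ⟨k, hk⟩ := Function.ne_iff.mp h
    refine Finset.prod_eq_zero (Finset.mem_univ k) ?_
    obtain ⟨x, hxT, hxS⟩ : ∃ x ∈ (T k).1, x ∉ (S k).1 := by
      by_contra! hsub
      exact hk (Subtype.ext (Finset.eq_of_subset_of_card_le hsub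
        (by rw [(S k).2, (T k).2])).symm)
    have hx : x ∈ Set.range (rows T k) := by
      rw [rows, Finset.range_orderEmbOfFin]
      exact hxT
    obtain ⟨p, hp⟩ := hx
    refine Matrix.det_eq_zero_of_row_eq_zero p fun q => ?_
    rw [Matrix.of_apply, if_neg]
    intro hq
    refine hxS ?_
    rw [← hp, ← hq]
    exact Finset.orderEmbOfFin_mem _ _ _

end Degeneration

/-! ### The Weyl relations for the top vector -/

section Relators

variable {r : ℕ} (m : Fin r → ℕ)

/-- The tensor factors: `m i` of them for the node `i`. -/
abbrev Factor : Type := Σ i : Fin r, Fin (m i)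

/-- The number of rows of the minors in a factor. -/
abbrev order (k : Factor m) : ℕ := k.1.val + 1

theorem order_le (k : Factor m) : order m k ≤ r + 1 := by
  have := k.1.isLt
  simp only [order]
  omega

variable {m}

theorem isDiag_specialize (z : Factor m → ℂ) (h : cartan r) (f : ℂ[X]) (k : Factor m) :
    (specialize r z (f ⊗ₜ h.val) k).IsDiag := by
  rw [specialize_tmul]
  exact (Matrix.IsDiag.map h.2 (map_zero _)).smul _

/-- The top minor of block `k` uses the rows up to `k.1.castSucc`, hence has weight `fundWeight
k.1`. -/
theorem matDeriv_cartan_topVector (z : Factor m → ℂ) (h : cartan r) (f : ℂ[X]) :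
    matDeriv (order m) (specialize r z (f ⊗ₜ h.val)) (topVector r (order_le m)) =
      (∑ k : Factor m, f.comp (Polynomial.C (z k) * Polynomial.X) *
        Polynomial.C (fundWeight k.1 h)) • topVector r (order_le m) := by
  refine derivation_prod_eigen _ _ _ _ fun k _ => ?_
  rw [matDeriv_minor_of_isDiag (isDiag_specialize z h f k)]
  congr 1
  simp only [specialize_tmul, Matrix.smul_apply, Matrix.map_apply, smul_eq_mul, ← Finset.mul_sum,
    ← map_sum]
  congr 2
  change _ = ∑ a ∈ Finset.Iic k.1.castSucc, h.val.val a a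
  refine Finset.sum_bij (fun p _ => Fin.castLE (order_le m k) p) ?_ ?_ ?_ ?_
  · intro p _
    have := p.isLt
    simp only [Finset.mem_Iic, Fin.le_def, Fin.val_castLE, Fin.val_castSucc]
    simp only [order] at this
    omega
  · intro p _ q _ hpq
    exact Fin.castLE_injective _ hpq
  · intro a ha
    simp only [Finset.mem_Iic, Fin.le_def, Fin.val_castSucc] at ha
    exact ⟨⟨a, Nat.lt_succ_of_le ha⟩, Finset.mem_univ _, rfl⟩
  · intro p _
    rfl

/-- Row `j + 1` is replaced by the earlier row `i`: either row `j + 1` is absent, or row `i` is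
present too and gets repeated. -/
theorem matDeriv_xPlus_topVector (z : Factor m → ℂ) {i j : Fin r} (h : i ≤ j) (f : ℂ[X]) :
    matDeriv (order m) (specialize r z (f ⊗ₜ xPlus i j h)) (topVector r (order_le m)) = 0 := by
  refine derivation_prod_eq_zero _ _ _ fun k _ => ?_
  by_cases hj : j.val + 1 < order m k
  · have hp : Fin.castLE (order_le m k) ⟨j.val + 1, hj⟩ = j.succ := Fin.ext rfl
    rw [matDeriv_minor_single (p := ⟨j.val + 1, hj⟩) (Fin.castLE_injective _)
      (by rw [hp]; exact specialize_single z f _ k)]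
    have hne : (⟨i.val, by have := Fin.le_def.mp h; omega⟩ : Fin (order m k)) ≠
        ⟨j.val + 1, hj⟩ := by
      have := Fin.le_def.mp h
      simp only [ne_eq, Fin.mk.injEq]
      omega
    rw [minor_eq_zero hne, smul_zero]
    rw [Function.update_self, Function.update_of_ne hne]
    exact Fin.ext rfl
  · refine matDeriv_minor_single_eq_zero (specialize_single z f _ k) fun p hp => hj ?_
    have := congrArg Fin.val hp
    simp only [Fin.val_castLE, Fin.val_succ] at this
    rw [← this]
    exact p.isLt

/-- Replacing row `i` by row `i + 1` gives something nonzero only if the top minor contains row `i`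
but not row `i + 1`, which means `k.1 = i`. -/
theorem matDeriv_xMinus_minor_of_ne (z : Factor m → ℂ) {i : Fin r} {k : Factor m} (hk : k.1 ≠ i) :
    matDeriv (order m) (specialize r z (1 ⊗ₜ xMinus i i le_rfl))
      (minor ℂ[X] (order m) k (Fin.castLE (order_le m k))) = 0 := by
  have hk' : k.1.val ≠ i.val := fun h => hk (Fin.ext h)
  by_cases hi : i.val + 1 < order m k
  · have hp : Fin.castLE (order_le m k) ⟨i.val, by omega⟩ = i.castSucc := Fin.ext rfl
    rw [matDeriv_minor_single (p := ⟨i.val, by omega⟩) (Fin.castLE_injective _)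
      (by rw [hp]; exact specialize_single z 1 _ k)]
    have hne : (⟨i.val + 1, hi⟩ : Fin (order m k)) ≠ ⟨i.val, by omega⟩ := by simp
    rw [minor_eq_zero hne, smul_zero]
    rw [Function.update_self, Function.update_of_ne hne]
    exact Fin.ext rfl
  · refine matDeriv_minor_single_eq_zero (specialize_single z 1 _ k) fun p hp => hi ?_
    have h1 := congrArg Fin.val hp
    have h2 := p.isLt
    simp only [Fin.val_castLE, Fin.val_castSucc] at h1
    simp only [order] at h2 ⊢
    omega

/-- After one application no row `i` is left to replace. -/
theorem matDeriv_matDeriv_xMinus_minor (z : Factor m → ℂ) (i : Fin r) (k : Factor m) :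
    matDeriv (order m) (specialize r z (1 ⊗ₜ xMinus i i le_rfl))
      (matDeriv (order m) (specialize r z (1 ⊗ₜ xMinus i i le_rfl))
        (minor ℂ[X] (order m) k (Fin.castLE (order_le m k)))) = 0 := by
  by_cases hk : k.1 = i
  · have hlt : i.val < order m k := by simp only [order, hk]; omega
    have hp : Fin.castLE (order_le m k) ⟨i.val, hlt⟩ = i.castSucc := Fin.ext rfl
    rw [matDeriv_minor_single (p := ⟨i.val, hlt⟩) (Fin.castLE_injective _)
      (by rw [hp]; exact specialize_single z 1 _ k), Derivation.map_smul]
    refine (congrArg _ (matDeriv_minor_single_eq_zero (specialize_single z 1 _ k)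
      fun p => ?_)).trans (smul_zero _)
    by_cases hpi : p = ⟨i.val, hlt⟩
    · rw [hpi, Function.update_self]
      exact (castSucc_ne_succ le_rfl).symm
    · rw [Function.update_of_ne hpi, ← hp]
      exact fun h => hpi (Fin.castLE_injective _ h)
  · rw [matDeriv_xMinus_minor_of_ne z hk, map_zero]

theorem card_filter_factor (i : Fin r) :
    (Finset.univ.filter fun k : Factor m => k.1 = i).card = m i := by
  have : (Finset.univ.filter fun k : Factor m => k.1 = i) =
      (Finset.univ : Finset (Fin (m i))).map (Function.Embedding.sigmaMk i) := by
    ext ⟨j, p⟩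
    simp only [Finset.mem_filter, Finset.mem_univ, true_and, Finset.mem_map]
    constructor
    · rintro rfl
      exact ⟨p, rfl⟩
    · rintro ⟨q, hq⟩
      exact (congrArg Sigma.fst hq).symm
  rw [this, Finset.card_map, Finset.card_univ, Fintype.card_fin]

theorem sum_factor_fundWeight (h : cartan r) :
    ∑ k : Factor m, fundWeight k.1 h = weight m h := by
  rw [weight, Fintype.sum_sigma]
  simp

/-- The defining relations of the Weyl module hold modulo `X` for the vector `topVector`. -/
theorem IsWeylRelator.exists_currentRep_eq_X_smul (z : Factor m → ℂ) {u : UCurrent r}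
    (hu : IsWeylRelator m u) : ∃ w ∈ orbitSpan r (order_le m) z,
      currentRep r (order m) z u (topVector r (order_le m)) = (Polynomial.X : ℂ[X]) • w := by
  cases hu with
  | raising i j h f =>
    refine ⟨0, Submodule.zero_mem _, ?_⟩
    rw [currentRep_cur, smul_zero]
    exact matDeriv_xPlus_topVector z h f
  | cartanPos h f =>
    -- The eigenvalue is divisible by `X` because `t` acts on block `k` as `z k` times `X`.
    refine ⟨(∑ k : Factor m, Polynomial.C (z k) * f.comp (Polynomial.C (z k) * Polynomial.X) *
        Polynomial.C (fundWeight k.1 h)) • topVector r (order_le m),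
      Submodule.smul_mem _ _ (topVector_mem_orbitSpan _ z), ?_⟩
    rw [currentRep_cur]
    refine (matDeriv_cartan_topVector z h _).trans ?_
    rw [smul_smul, Finset.mul_sum]
    congr 1
    refine Finset.sum_congr rfl fun k _ => ?_
    rw [Polynomial.mul_comp, Polynomial.X_comp]
    ring
  | highestWeight h =>
    refine ⟨0, Submodule.zero_mem _, ?_⟩
    rw [map_sub, currentRep_cur, AlgHom.commutes, LinearMap.sub_apply, smul_zero, sub_eq_zero]
    refine (matDeriv_cartan_topVector z h 1).trans ?_
    simp only [Polynomial.one_comp, one_mul, ← map_sum, sum_factor_fundWeight]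
    exact algebraMap_smul ℂ[X] (weight m h) (topVector r (order_le m))
  | lowering i =>
    refine ⟨0, Submodule.zero_mem _, ?_⟩
    rw [map_pow, currentRep_cur, smul_zero]
    -- Only the `m i` factors of node `i` can be lowered, each at most once.
    have h := derivation_pow_prod_eq_zero
      (matDeriv (order m) (specialize r z (1 ⊗ₜ xMinus i i le_rfl))) Finset.univ
      (Finset.univ.filter fun k : Factor m => k.1 = i)
      (fun k => minor ℂ[X] (order m) k (Fin.castLE (order_le m k)))
      (fun k _ hk => matDeriv_xMinus_minor_of_ne z (by simpa using hk))
      (fun k _ => matDeriv_matDeriv_xMinus_minor z i k)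
    rwa [Finset.univ_inter, card_filter_factor] at h

theorem card_rowSets : Fintype.card (RowSets r (order m)) =
    ∏ i : Fin r, (r + 1).choose (i.val + 1) ^ m i := by
  rw [Fintype.card_pi]
  simp only [Fintype.card_finset_len, Fintype.card_fin, order]
  rw [Fintype.prod_sigma]
  simp

end Relators

end CurrentAlgebra

end

theorem corollary1p3p5 (r : ℕ) (m : Fin r → ℕ) :
    ((∏ i : Fin r, (r + 1).choose (i.val + 1) ^ m i : ℕ) : Cardinal) ≤
      Module.rank ℂ (CurrentAlgebra.WeylModule m) := by
  classical
  let z : CurrentAlgebra.Factor m → ℂ := fun k => ((Fintype.equivFin _ k : ℕ) : ℂ)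
  have hz : Function.Injective z := fun k l h =>
    (Fintype.equivFin _).injective (Fin.ext (Nat.cast_injective h))
  rw [← CurrentAlgebra.card_rowSets]
  -- Evaluation at the points `rowPoint S` supplies coordinates in which the products of minors are
  -- the standard basis.
  refine CurrentAlgebra.card_le_rank_quotient_of_degeneration
    (CurrentAlgebra.currentRep r (CurrentAlgebra.order m) z)
    (CurrentAlgebra.topVector r (CurrentAlgebra.order_le m)) _
    (LinearMap.pi fun S => (MvPolynomial.aeval (CurrentAlgebra.rowPoint S)).toLinearMap)
    (fun u hu => hu.exists_currentRep_eq_X_smul z) fun T => ?_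
  obtain ⟨c, hc, hcm⟩ := CurrentAlgebra.exists_smul_prod_minor_mem (CurrentAlgebra.order_le m) hz
    (CurrentAlgebra.rows T) (fun k => ((T k).1.orderEmbOfFin (T k).2).injective)
  refine ⟨c, hc, _, hcm, ?_⟩
  ext1 S
  simp only [LinearMap.pi_apply, AlgHom.toLinearMap_apply, map_smul,
    CurrentAlgebra.aeval_rowPoint_prod_minor, Pi.single_apply]
  split_ifs <;> simp
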